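/- Let $n>1$ and let $K_n$ be Kiselman's semigroup, i.e. the monoid with presentation $$K_n=\langle a_1,\dots,a_n \mid a_i^2=a_i,\ a_ia_ja_i=a_ja_ia_j=a_ia_j,\ 1\le j<i\le n\rangle,$$ with unit element $e$ and zero element $f=a_na_{n-1}\cdots a_1$. Let $(X_j)_{j\ge 1}$ be a sequence of independent and identically distributed random variables on a probability space $(\Omega,\mathcal F,\mathbb P)$ with values in $\{a_1,\dots,a_n\}$. Set $p_i=\mathbb P(X_1=a_i)$ for $1\le i\le n$, let $P_0=e$ and $P_j=X_1X_2\cdots X_j$ for $j\ge 1$, and let $$T=\inf\{j\ge 0 \mid P_j=f\}\in\{0,1,2,\dots\}\cup\{\infty\}$$ be the hitting time of the zero element. If $p_i>0$ for all $i=1,\dots,n$, then $$\mathbb E[T]=\sum_{i=1}^n \frac1{p_i}.$$ In particular, if the $X_j$ are uniformly distributed on $\{a_1,\dots,a_n\}$, then $\mathbb E[T]=n^2$. -/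

import Mathlib

open MeasureTheory ProbabilityTheory
open scoped ENNReal

/-- The defining relations of Kiselman's semigroup on the letters `a_i`, `i : Fin n`. The element
`i : Fin n` stands for the index `i + 1` of `{1, …, n}`; only the order of the indices matters. -/
inductive KiselmanRel (n : ℕ) : FreeMonoid (Fin n) → FreeMonoid (Fin n) → Prop
  | idem (i : Fin n) : KiselmanRel n (.of i * .of i) (.of i)
  | left (i j : Fin n) (h : j < i) :
      KiselmanRel n (.of i * .of j * .of i) (.of i * .of j)
  | right (i j : Fin n) (h : j < i) :
      KiselmanRel n (.of j * .of i * .of j) (.of i * .of j)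

/-- Kiselman's semigroup `K_n`, as the monoid with presentation
`⟨a_1, …, a_n ∣ a_i ^ 2 = a_i, a_i a_j a_i = a_j a_i a_j = a_i a_j for j < i⟩`. -/
def Kiselman (n : ℕ) : Type := PresentedMonoid (KiselmanRel n)

namespace Kiselman

variable {n : ℕ}

instance instMonoid : Monoid (Kiselman n) :=
  inferInstanceAs (Monoid (PresentedMonoid (KiselmanRel n)))

/-- The generators `a_i` of `K_n`. -/
def gen (i : Fin n) : Kiselman n := PresentedMonoid.of (KiselmanRel n) i

/-- The element `a_n a_{n-1} ⋯ a_1`. -/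
def zeroElt (n : ℕ) : Kiselman n := ((List.finRange n).reverse.map gen).prod

theorem gen_idem (i : Fin n) : gen i * gen i = gen i :=
  PresentedMonoid.mk_eq_mk_of_rel (KiselmanRel.idem i)

theorem gen_left {i j : Fin n} (h : j < i) : gen i * gen j * gen i = gen i * gen j :=
  PresentedMonoid.mk_eq_mk_of_rel (KiselmanRel.left i j h)

theorem gen_right {i j : Fin n} (h : j < i) : gen j * gen i * gen j = gen i * gen j :=
  PresentedMonoid.mk_eq_mk_of_rel (KiselmanRel.right i j h)

theorem gen_prod_gen_of_lt (i : Fin n) (l : List (Fin n)) (hl : ∀ b ∈ l, b < i) :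
    gen i * (l.map gen).prod * gen i = gen i * (l.map gen).prod := by
  induction l with
  | nil => simp [gen_idem]
  | cons b l ih =>
    have hb := gen_left (hl b (by simp))
    have ih := ih fun c hc => hl c (by simp [hc])
    simp only [List.map_cons, List.prod_cons]
    calc gen i * (gen b * (l.map gen).prod) * gen i
        = (gen i * gen b) * (l.map gen).prod * gen i := by simp only [mul_assoc]
      _ = gen i * gen b * (gen i * (l.map gen).prod * gen i) := by
          conv_lhs => rw [← hb]
          simp only [mul_assoc]
      _ = (gen i * gen b * gen i) * (l.map gen).prod := by rw [ih]; simp only [mul_assoc]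
      _ = gen i * (gen b * (l.map gen).prod) := by rw [hb]; simp only [mul_assoc]

theorem gen_prod_gen_of_gt (i : Fin n) (l : List (Fin n)) (hl : ∀ b ∈ l, i < b) :
    gen i * (l.map gen).prod * gen i = (l.map gen).prod * gen i := by
  induction l with
  | nil => simp [gen_idem]
  | cons b l ih =>
    have hb := gen_right (hl b (by simp))
    have ih := ih fun c hc => hl c (by simp [hc])
    simp only [List.map_cons, List.prod_cons]
    calc gen i * (gen b * (l.map gen).prod) * gen i
        = gen i * gen b * ((l.map gen).prod * gen i) := by simp only [mul_assoc]
      _ = (gen i * gen b * gen i) * (l.map gen).prod * gen i := by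
          rw [← ih]; simp only [mul_assoc]
      _ = gen b * (gen i * (l.map gen).prod * gen i) := by rw [hb]; simp only [mul_assoc]
      _ = gen b * (l.map gen).prod * gen i := by rw [ih]; simp only [mul_assoc]

theorem gen_mul_zeroElt (i : Fin n) :
    gen i * zeroElt n = zeroElt n ∧ zeroElt n * gen i = zeroElt n := by
  have hp : (List.finRange n).reverse.Pairwise (· > ·) := by
    rw [List.pairwise_reverse]; exact List.pairwise_lt_finRange n
  obtain ⟨s, t, hst⟩ := List.append_of_mem
    (List.mem_reverse.2 (List.mem_finRange i) : i ∈ (List.finRange n).reverse)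
  rw [hst, List.pairwise_append, List.pairwise_cons] at hp
  have hs := gen_prod_gen_of_gt i s fun b hb => hp.2.2 b hb i (by simp)
  have ht := gen_prod_gen_of_lt i t fun b hb => hp.2.1.1 b hb
  have hz : zeroElt n = (s.map gen).prod * (gen i * (t.map gen).prod) := by
    simp [zeroElt, hst]
  rw [hz]
  constructor
  · calc gen i * ((s.map gen).prod * (gen i * (t.map gen).prod))
        = (gen i * (s.map gen).prod * gen i) * (t.map gen).prod := by simp only [mul_assoc]
      _ = _ := by rw [hs]; simp only [mul_assoc]
  · rw [mul_assoc, ht]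

theorem mul_zeroElt (x : Kiselman n) : x * zeroElt n = zeroElt n ∧ zeroElt n * x = zeroElt n := by
  let φ : FreeMonoid (Fin n) →* Kiselman n := PresentedMonoid.mk (KiselmanRel n)
  obtain ⟨w, rfl⟩ : ∃ w, φ w = x := PresentedMonoid.surjective_mk x
  induction w with
  | one => simp
  | of i => exact gen_mul_zeroElt i
  | mul u v hu hv =>
    rw [map_mul]
    exact ⟨by rw [mul_assoc, hv.1, hu.1], by rw [← mul_assoc, hu.2, hv.2]⟩

/-- `K_n` is a monoid with zero, whose zero element is `a_n a_{n-1} ⋯ a_1`. -/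
instance instMonoidWithZero : MonoidWithZero (Kiselman n) where
  zero := zeroElt n
  zero_mul x := (mul_zeroElt x).2
  mul_zero x := (mul_zeroElt x).1

/-- `K_n` carries the discrete σ-algebra. -/
instance instMeasurableSpace : MeasurableSpace (Kiselman n) := ⊤

instance instDiscreteMeasurableSpace : DiscreteMeasurableSpace (Kiselman n) := ⟨fun _ => trivial⟩

/-- The partial products `P_0 = e`, `P_{j+1} = P_j X_{j+1}` of a sequence `X_1, X_2, …` of
`K_n`-valued functions. Sequences are indexed from `0` here: `X j` stands for `X_{j+1}`. -/
def partialProd {Ω : Type*} (X : ℕ → Ω → Kiselman n) : ℕ → Ω → Kiselman n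
  | 0, _ => 1
  | j + 1, ω => partialProd X j ω * X j ω

/-- The hitting time `T = inf {j ≥ 0 ∣ P_j = 0}` of the zero element by the partial products;
it is `⊤` at the sample points where the zero element is never reached. -/
noncomputable def hittingTime {Ω : Type*} (X : ℕ → Ω → Kiselman n) : Ω → ℕ∞ :=
  hittingAfter (partialProd X) {0} 0

end Kiselman

/-!
The monoid `K_n` acts from the right on `{0, …, n}`: the letter `a_i` moves the state `s` to `s + 1`
if `i = n - s`, and fixes every other state. The state `stage x` reached from `0` by `x` is thus the number of letters of the pattern `a_n a_{n-1} ⋯ a_1`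
that are found, greedily from the left, in any word for `x`. The point is that this
statistic detects the zero element, `x = 0 ↔ stage x = n` (`Kiselman.eq_zero_iff_stage`). The
nontrivial direction holds because, once the letters `a_n, …, a_k` have been collected, `x` absorbs
on the right every `a_k` that follows a word in smaller letters
(`Kiselman.mul_prod_mul_gen_of_le_stage`); if `stage x = n`, all letters are absorbed, so
`x = x * 0 = 0`.

Hence `T` is the time at which the process `stage (P_j)`, which climbs one step at a time, reaches
`n`. It leaves the state `k` when the letter `a_{n-k}` arrives. Since `X_{j+1}` is independent of
`P_j`, summing `ℙ(stage P_{j+1} > k) - ℙ(stage P_j > k) = p_{n-k} ℙ(stage P_j = k)` over `j`,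
with `ℙ(stage P_j > k) → 1` (`Kiselman.tendsto_measure_lt_stage`), shows that the expected time spent in the state `k` is `1 / p_{n-k}`
(`Kiselman.tsum_measure_stage_eq`), and `𝔼[T]` is the sum of these times over `k < n`.
-/

open Filter Topology

namespace Kiselman

variable {n : ℕ}

/-! ### The stage of an element and the zero element -/

/-- The action of the letter `i` on the states: `s` counts the letters already collected of the
pattern `n - 1, n - 2, …, 0`, so the next letter that is waited for is `i` with `i + s + 1 = n`. -/
def stageStep (i : Fin n) : Function.End ℕ := fun s : ℕ => if i + s + 1 = n then s + 1 else s

/-- The right action of `K_n` on the states, as a homomorphism to the opposite of the monoid of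
self-maps. -/
def stageHom (n : ℕ) : Kiselman n →* (Function.End ℕ)ᵐᵒᵖ :=
  PresentedMonoid.lift (rels := KiselmanRel n) (fun i => MulOpposite.op (stageStep i)) (by
    intro a b hab
    cases hab <;>
    · simp only [map_mul, FreeMonoid.lift_eval_of, ← MulOpposite.op_mul]
      congr 1
      funext s
      have h₁ (i : Fin n) : stageStep i s = if i + s + 1 = n then s + 1 else s := rfl
      have h₂ (i : Fin n) (g : Function.End ℕ) :
          (stageStep i * g) s = if i + g s + 1 = n then g s + 1 else g s := rfl
      simp only [h₁, h₂]
      split_ifs <;> omega)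

/-- The length of the longest initial part of `a_n a_{n-1} ⋯ a_1` that is a subsequence of a word
for `x`. -/
def stage (x : Kiselman n) : ℕ := (stageHom n x).unop (0 : ℕ)

@[simp] theorem stage_one : stage (1 : Kiselman n) = 0 := by
  rw [stage, map_one]
  rfl

theorem stage_mul_gen (x : Kiselman n) (i : Fin n) :
    stage (x * gen i) = stageStep i (stage x) := by
  have h : stageHom n (gen i) = MulOpposite.op (stageStep i) := rfl
  rw [stage, map_mul, h]
  rfl

theorem induction_mul_gen {p : Kiselman n → Prop} (one : p 1)
    (mul_gen : ∀ x i, p x → p (x * gen i)) (x : Kiselman n) : p x := by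
  have hx : x ∈ Submonoid.closure (Set.range (gen : Fin n → Kiselman n)) :=
    (PresentedMonoid.closure_range_of (KiselmanRel n)).symm ▸ Submonoid.mem_top _
  induction hx using Submonoid.closure_induction_right with
  | one => exact one
  | mul_right x _ y hy ih =>
    obtain ⟨i, rfl⟩ := hy
    exact mul_gen x i ih

instance instCountable : Countable (Kiselman n) :=
  (PresentedMonoid.surjective_mk (rels := KiselmanRel n)).countable

theorem stage_le (x : Kiselman n) : stage x ≤ n := by
  induction x using induction_mul_gen with
  | one => simp
  | mul_gen x i ih =>
    rw [stage_mul_gen, stageStep]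
    split_ifs <;> omega

/-- If the letters `a_n, …, a_k` have been collected in `x`, then `x` absorbs every later `a_k` that
is preceded by smaller letters only. -/
theorem mul_prod_mul_gen_of_le_stage (x : Kiselman n) (k : Fin n) (hk : n ≤ k + stage x)
    (u : List (Fin n)) (hu : ∀ b ∈ u, b < k) :
    x * (u.map gen).prod * gen k = x * (u.map gen).prod := by
  induction x using induction_mul_gen generalizing k u with
  | one => simp at hk; omega
  | mul_gen x i ih =>
    rw [stage_mul_gen, stageStep] at hk
    by_cases hik : i < k
    · have hk' : n ≤ k + stage x := by split_ifs at hk <;> omega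
      have := ih k hk' (i :: u) (by simpa [hik] using hu)
      simpa [mul_assoc] using this
    split_ifs at hk with hi
    · -- The letter `i` is the one just collected, so `k = i`.
      obtain rfl : k = i := by omega
      rw [mul_assoc x, mul_assoc x, gen_prod_gen_of_lt k u hu]
    · have hxi : x * gen i = x := by simpa using ih i (by omega) [] (by simp)
      rw [hxi]
      exact ih k hk u hu

theorem eq_zero_iff_stage (x : Kiselman n) : x = 0 ↔ stage x = n := by
  constructor
  · rintro rfl
    by_contra h
    have hlt : stage (0 : Kiselman n) < n := lt_of_le_of_ne (stage_le _) h
    have := stage_mul_gen (0 : Kiselman n) ⟨n - 1 - stage (0 : Kiselman n), by omega⟩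
    rw [zero_mul, stageStep, if_pos (by simp only; omega)] at this
    omega
  · intro h
    have hx (k : Fin n) : x * gen k = x := by
      simpa using mul_prod_mul_gen_of_le_stage x k (by omega) [] (by simp)
    have hy (y : Kiselman n) : x * y = x := by
      induction y using induction_mul_gen with
      | one => simp
      | mul_gen y i ih => rw [← mul_assoc, ih, hx]
    rw [← hy 0, mul_zero]

theorem lt_stage_mul_iff {x y : Kiselman n} (hy : y ∈ Set.range (gen : Fin n → Kiselman n))
    {k : ℕ} {i : Fin n} (hik : i + k + 1 = n) :
    k < stage (x * y) ↔ k < stage x ∨ (stage x = k ∧ y = gen i) := by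
  constructor
  · obtain ⟨i', rfl⟩ := hy
    rw [stage_mul_gen, stageStep]
    split_ifs with h
    · intro hk
      rcases (Nat.lt_succ_iff.1 hk).lt_or_eq with hk | hk
      · exact .inl hk
      · exact .inr ⟨hk.symm, congrArg gen (by omega)⟩
    · exact .inl
  · rintro (h | ⟨rfl, rfl⟩)
    · obtain ⟨i', rfl⟩ := hy
      rw [stage_mul_gen, stageStep]
      split_ifs <;> omega
    · rw [stage_mul_gen, stageStep, if_pos hik]
      omega

/-! ### Partial products and the hitting time -/

section PartialProducts

variable {Ω : Type*} {X : ℕ → Ω → Kiselman n}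

theorem partialProd_eq_zero_of_le {i j : ℕ} (hij : i ≤ j) {ω : Ω} (h : partialProd X i ω = 0) :
    partialProd X j ω = 0 := by
  induction j, hij using Nat.le_induction with
  | base => exact h
  | succ j _ ih => rw [partialProd, ih, zero_mul]

theorem hittingTime_le_iff {j : ℕ} {ω : Ω} : hittingTime X ω ≤ j ↔ partialProd X j ω = 0 := by
  refine hittingAfter_le_iff.trans ⟨?_, fun h => ⟨j, by simp, h⟩⟩
  rintro ⟨i, hi, h⟩
  exact partialProd_eq_zero_of_le hi.2 h

theorem lt_hittingTime_iff {j : ℕ} {ω : Ω} : (j : ℕ∞) < hittingTime X ω ↔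
    partialProd X j ω ≠ 0 := by
  rw [← not_le, hittingTime_le_iff]

/-- A number in `ℕ∞` counts the natural numbers below it. -/
theorem _root_.ENat.toENNReal_eq_tsum_indicator_lt (t : ℕ∞) :
    (t : ℝ≥0∞) = ∑' j : ℕ, {j : ℕ | (j : ℕ∞) < t}.indicator 1 j := by
  rw [← tsum_subtype]
  simp only [Pi.one_apply, ENNReal.tsum_set_one]
  congr 1
  induction t with
  | top => simp
  | coe m =>
    have : {j : ℕ | (j : ℕ∞) < m} = (Finset.range m : Set ℕ) := by ext; simp
    rw [this, Set.encard_coe_eq_coe_finsetCard, Finset.card_range]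

theorem measurable_partialProd [MeasurableSpace Ω] (hX : ∀ j, Measurable (X j)) (j : ℕ) :
    Measurable (partialProd X j) := by
  induction j with
  | zero => exact measurable_const
  | succ j ih =>
    exact (measurable_of_countable fun p : Kiselman n × Kiselman n => p.1 * p.2).comp
      (ih.prodMk (hX j))

theorem measurable_hittingTime [MeasurableSpace Ω] (hX : ∀ j, Measurable (X j)) :
    Measurable (hittingTime X) := by
  refine ENat.measurable_iff.2 fun m => ?_
  have : hittingTime X ⁻¹' {(m : ℕ∞)} =
      partialProd X m ⁻¹' {0} ∩ ⋂ j ∈ Finset.range m, partialProd X j ⁻¹' {0}ᶜ := by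
    ext ω
    simp only [Set.mem_preimage, Set.mem_singleton_iff, Set.mem_inter_iff, Set.mem_iInter,
      Finset.mem_range, Set.mem_compl_iff, ← hittingTime_le_iff, not_le]
    constructor
    · rintro h
      rw [h]
      exact ⟨le_rfl, fun j hj => by exact_mod_cast hj⟩
    · rintro ⟨h₁, h₂⟩
      refine h₁.antisymm (le_of_not_gt fun h => ?_)
      lift hittingTime X ω to ℕ using ne_top_of_lt h with t
      exact lt_irrefl _ (h₂ t (by exact_mod_cast h))
  rw [this]
  exact (measurable_partialProd hX m .of_discrete).inter
    (Finset.measurableSet_biInter _ fun j _ => measurable_partialProd hX j .of_discrete)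

theorem partialProd_congr {Ω' : Type*} {Y : ℕ → Ω' → Kiselman n} {ω : Ω} {ω' : Ω'} {j : ℕ}
    (h : ∀ i < j, X i ω = Y i ω') : partialProd X j ω = partialProd Y j ω' := by
  induction j with
  | zero => rfl
  | succ j ih => rw [partialProd, partialProd, ih fun i hi => h i (by omega), h j (by omega)]

theorem indepFun_partialProd [MeasurableSpace Ω] {P : Measure Ω} (hX : ∀ j, Measurable (X j))
    (hind : iIndepFun X P) (j : ℕ) : IndepFun (partialProd X j) (X j) P := by
  have h := hind.indepFun_finset (Finset.range j) {j} (by simp) hX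
  -- `P_j` is the `j`-th partial product of the coordinate process on `K_n ^ j`, extended by `1`.
  let Y (i : ℕ) (f : Finset.range j → Kiselman n) : Kiselman n :=
    if hi : i ∈ Finset.range j then f ⟨i, hi⟩ else 1
  have hY (i : ℕ) : Measurable (Y i) := by
    by_cases hi : i ∈ Finset.range j
    · simp only [Y, dif_pos hi]
      exact measurable_pi_apply _
    · simp only [Y, dif_neg hi]
      exact measurable_const
  have h' := h.comp (measurable_partialProd hY j)
    (measurable_pi_apply (⟨j, Finset.mem_singleton_self j⟩ : ({j} : Finset ℕ)))
  have hYX : partialProd X j = partialProd Y j ∘ fun ω (i : Finset.range j) => X i ω :=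
    funext fun ω => partialProd_congr fun i hi => by simp [Y, hi]
  rw [hYX]
  exact h'

/-! ### Expected time in each stage -/

variable [MeasurableSpace Ω] {P : Measure Ω}

theorem measure_lt_stage_succ (hX : ∀ j, Measurable (X j))
    (hgen : ∀ j ω, X j ω ∈ Set.range (gen : Fin n → Kiselman n)) (hind : iIndepFun X P)
    (hid : ∀ j, IdentDistrib (X j) (X 0) P P) {k : ℕ} {i : Fin n} (hik : i + k + 1 = n) (j : ℕ) :
    P {ω | k < stage (partialProd X (j + 1) ω)} =
      P {ω | k < stage (partialProd X j ω)} +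
        P {ω | stage (partialProd X j ω) = k} * P {ω | X 0 ω = gen i} := by
  have hset : {ω | k < stage (partialProd X (j + 1) ω)} =
      {ω | k < stage (partialProd X j ω)} ∪
        (partialProd X j ⁻¹' {x | stage x = k} ∩ X j ⁻¹' {gen i}) := by
    ext ω
    exact lt_stage_mul_iff (hgen j ω) hik
  have hdisj : Disjoint {ω | k < stage (partialProd X j ω)}
      (partialProd X j ⁻¹' {x | stage x = k} ∩ X j ⁻¹' {gen i}) :=
    Set.disjoint_left.2 fun ω h₁ h₂ => (ne_of_gt h₁) h₂.1
  have hm := measurable_partialProd hX j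
  rw [hset, measure_union hdisj ((hm .of_discrete).inter (hX j .of_discrete)),
    (indepFun_partialProd hX hind j).measure_inter_preimage_eq_mul _ _ .of_discrete .of_discrete,
    (hid j).measure_preimage_eq .of_discrete]
  rfl

theorem measure_lt_stage (hX : ∀ j, Measurable (X j))
    (hgen : ∀ j ω, X j ω ∈ Set.range (gen : Fin n → Kiselman n)) (hind : iIndepFun X P)
    (hid : ∀ j, IdentDistrib (X j) (X 0) P P) {k : ℕ} {i : Fin n} (hik : i + k + 1 = n) (m : ℕ) :
    P {ω | k < stage (partialProd X m ω)} =
      (∑ j ∈ Finset.range m, P {ω | stage (partialProd X j ω) = k}) * P {ω | X 0 ω = gen i} := by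
  induction m with
  | zero => simp [partialProd]
  | succ m ih =>
    rw [measure_lt_stage_succ hX hgen hind hid hik, ih, Finset.sum_range_succ, add_mul]

variable [IsProbabilityMeasure P]

theorem tsum_measure_stage_ne_top (hX : ∀ j, Measurable (X j))
    (hgen : ∀ j ω, X j ω ∈ Set.range (gen : Fin n → Kiselman n)) (hind : iIndepFun X P)
    (hid : ∀ j, IdentDistrib (X j) (X 0) P P) {k : ℕ} {i : Fin n} (hik : i + k + 1 = n)
    (hi : 0 < P {ω | X 0 ω = gen i}) :
    ∑' j, P {ω | stage (partialProd X j ω) = k} ≠ ∞ := by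
  refine ne_top_of_le_ne_top (ENNReal.inv_ne_top.2 hi.ne')
    (ENNReal.tsum_le_of_sum_range_le fun m => ?_)
  rw [ENNReal.le_inv_iff_mul_le, ← measure_lt_stage hX hgen hind hid hik]
  exact prob_le_one

/-- The walk leaves every stage `k < n` almost surely: all stages up to `k` have finite expected
occupation time, so their probabilities tend to `0`. -/
theorem tendsto_measure_lt_stage (hX : ∀ j, Measurable (X j))
    (hgen : ∀ j ω, X j ω ∈ Set.range (gen : Fin n → Kiselman n)) (hind : iIndepFun X P)
    (hid : ∀ j, IdentDistrib (X j) (X 0) P P) (hpos : ∀ i : Fin n, 0 < P {ω | X 0 ω = gen i})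
    {k : ℕ} (hk : k < n) :
    Tendsto (fun m => P {ω | k < stage (partialProd X m ω)}) atTop (𝓝 1) := by
  have h0 : Tendsto (fun m => ∑ l ∈ Finset.range (k + 1),
      P {ω | stage (partialProd X m ω) = l}) atTop (𝓝 0) := by
    rw [← Finset.sum_const_zero (s := Finset.range (k + 1))]
    refine tendsto_finsetSum _ fun l hl => ENNReal.tendsto_atTop_zero_of_tsum_ne_top ?_
    rw [Finset.mem_range] at hl
    exact tsum_measure_stage_ne_top hX hgen hind hid
      (i := ⟨n - 1 - l, by omega⟩) (by simp only; omega) (hpos _)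
  have h1 : Tendsto (fun m => P {ω | stage (partialProd X m ω) ≤ k}) atTop (𝓝 0) := by
    refine tendsto_of_tendsto_of_tendsto_of_le_of_le tendsto_const_nhds h0 (fun _ => zero_le)
      fun m => le_trans (measure_mono fun ω hω => ?_) (measure_biUnion_finset_le _ _)
    simpa [Nat.lt_succ_iff] using hω
  have h2 := ENNReal.Tendsto.sub (tendsto_const_nhds (x := (1 : ℝ≥0∞))) h1
    (.inl ENNReal.one_ne_top)
  rw [tsub_zero] at h2
  refine h2.congr fun m => ?_
  have hm : MeasurableSet {ω | stage (partialProd X m ω) ≤ k} :=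
    measurable_partialProd hX m (.of_discrete (s := {x | stage x ≤ k}))
  rw [← prob_compl_eq_one_sub hm]
  congr 1
  ext ω
  simp

theorem tsum_measure_stage_eq (hX : ∀ j, Measurable (X j))
    (hgen : ∀ j ω, X j ω ∈ Set.range (gen : Fin n → Kiselman n)) (hind : iIndepFun X P)
    (hid : ∀ j, IdentDistrib (X j) (X 0) P P) (hpos : ∀ i : Fin n, 0 < P {ω | X 0 ω = gen i})
    {k : ℕ} {i : Fin n} (hik : i + k + 1 = n) :
    ∑' j, P {ω | stage (partialProd X j ω) = k} = (P {ω | X 0 ω = gen i})⁻¹ := by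
  refine ENNReal.eq_inv_of_mul_eq_one_left (tendsto_nhds_unique ?_
    (tendsto_measure_lt_stage hX hgen hind hid hpos (k := k) (by omega)))
  simp_rw [measure_lt_stage hX hgen hind hid hik]
  exact ENNReal.Tendsto.mul_const (ENNReal.tendsto_nat_tsum _) (.inr (measure_ne_top _ _))

theorem lintegral_hittingTime (hX : ∀ j, Measurable (X j))
    (hgen : ∀ j ω, X j ω ∈ Set.range (gen : Fin n → Kiselman n)) (hind : iIndepFun X P)
    (hid : ∀ j, IdentDistrib (X j) (X 0) P P) (hpos : ∀ i : Fin n, 0 < P {ω | X 0 ω = gen i}) :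
    ∫⁻ ω, (hittingTime X ω : ℝ≥0∞) ∂P = ∑ i : Fin n, (P {ω | X 0 ω = gen i})⁻¹ := by
  have hm (j : ℕ) (s : Set (Kiselman n)) : MeasurableSet (partialProd X j ⁻¹' s) :=
    measurable_partialProd hX j .of_discrete
  have hT (ω : Ω) : (hittingTime X ω : ℝ≥0∞) =
      ∑' j, (partialProd X j ⁻¹' {0}ᶜ).indicator (1 : Ω → ℝ≥0∞) ω := by
    rw [ENat.toENNReal_eq_tsum_indicator_lt]
    refine tsum_congr fun j => ?_
    by_cases h : partialProd X j ω = 0 <;> simp [lt_hittingTime_iff, h]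
  have hsplit (j : ℕ) : P (partialProd X j ⁻¹' {0}ᶜ) =
      ∑ i : Fin n, P {ω | stage (partialProd X j ω) = i.rev} := by
    have hset : partialProd X j ⁻¹' {0}ᶜ =
        ⋃ i ∈ (Finset.univ : Finset (Fin n)), {ω | stage (partialProd X j ω) = i.rev} := by
      ext ω
      simp only [Set.mem_preimage, Set.mem_compl_iff, Set.mem_singleton_iff, eq_zero_iff_stage,
        Finset.mem_univ, Set.iUnion_true, Set.mem_iUnion, Set.mem_ofPred_eq]
      constructor
      · intro h
        exact ⟨Fin.rev ⟨_, lt_of_le_of_ne (stage_le _) h⟩, by simp⟩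
      · rintro ⟨i, h⟩
        exact h ▸ i.rev.isLt.ne
    rw [hset, measure_biUnion_finset]
    · intro a _ b _ hab
      refine Set.disjoint_left.2 fun ω h₁ h₂ => hab (Fin.rev_injective (Fin.ext ?_))
      exact h₁.symm.trans h₂
    · exact fun i _ => hm j {x | stage x = i.rev}
  simp_rw [hT]
  rw [lintegral_tsum fun j => (measurable_one.indicator (hm j _)).aemeasurable]
  simp_rw [lintegral_indicator_one (hm _ _), hsplit]
  rw [Summable.tsum_finsetSum fun _ _ => ENNReal.summable]
  exact Finset.sum_congr rfl fun i _ => tsum_measure_stage_eq hX hgen hind hid hpos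
    (by rw [Fin.val_rev]; omega)

end PartialProducts

end Kiselman

theorem mainTheorem6 (n : ℕ) (hn : 1 < n)
    {Ω : Type*} [MeasurableSpace Ω] (P : Measure Ω) [IsProbabilityMeasure P]
    (X : ℕ → Ω → Kiselman n)
    (hX_meas : ∀ j, Measurable (X j))
    (hX_gen : ∀ j ω, X j ω ∈ Set.range (Kiselman.gen : Fin n → Kiselman n))
    (hX_indep : iIndepFun X P)
    (hX_ident : ∀ j, IdentDistrib (X j) (X 0) P P) :
    Measurable (Kiselman.hittingTime X) ∧
    ((∀ i : Fin n, 0 < P {ω | X 0 ω = Kiselman.gen i}) →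
      ∫⁻ ω, (Kiselman.hittingTime X ω : ℝ≥0∞) ∂P
        = ∑ i : Fin n, (P {ω | X 0 ω = Kiselman.gen i})⁻¹) ∧
    ((∀ i : Fin n, P {ω | X 0 ω = Kiselman.gen i} = 1 / (n : ℝ≥0∞)) →
      ∫⁻ ω, (Kiselman.hittingTime X ω : ℝ≥0∞) ∂P = (n : ℝ≥0∞) ^ 2) := by
  refine ⟨Kiselman.measurable_hittingTime hX_meas,
    Kiselman.lintegral_hittingTime hX_meas hX_gen hX_indep hX_ident, fun h => ?_⟩
  rw [Kiselman.lintegral_hittingTime hX_meas hX_gen hX_indep hX_ident fun i => by simp [h]]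
  simp [h, sq]
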